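/- A loop is a set $Q$ with a binary operation and a two-sided identity $1$ such that all translations $L_x(y)=xy$ and $R_x(y)=yx$ are permutations of $Q$; it is Moufang if $xy\cdot zx=(x\cdot yz)x$ for all $x,y,z\in Q$. Let $T_a=R_a^{-1}L_a$ be the conjugation by $a$ (products of permutations are compositions) and $a^n=L_a^n(1)$ for $n\in\mathbb Z$. A subloop of $Q$ is normal if it is mapped onto itself by every inner mapping, i.e. by every element of $\langle L_x,R_x:x\in Q\rangle$ that fixes $1$. A permutation $f$ of an abelian group $(X,+)$ is a Moufang permutation if the mapping $$\beta(x,y)=f^{-1}(f(x)+f(y))-x-y$$ (called the biadditive mapping associated with $f$) is symmetric, alternating ($\beta(x,x)=0$) and biadditive, and if $\beta(\beta(x,y),z)=0$ and $\beta(f(x),f(y))=f(\beta(f^3(x),y))$ for all $x,y,z\in X$. For $i,j\in\mathbb Z$ let $I(i,j)=\emptyset$ if $i=j$, $I(i,j)=\{i,i+1,\dots,j-1\}$ if $i<j$, and $I(i,j)=\{j,j+1,\dots,i-1\}$ if $j<i$. **Theorem 8.1.** Let $Q$ be a Moufang loop and let $X$ be an abelian normal subgroup of $Q$, that is, a normal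 subloop that is associative and commutative; write $x+y=xy$ for $x,y\in X$. Let $a\in Q$ and let $f$ be the restriction of $T_a$ to $X$ (a permutation of $X$, as $X$ is normal). Then $f$ is a Moufang permutation on $(X,+)$. For each $x\in X$ the permutation $\mu_x=R_x^{-1}f^{-1}R_{f(x)}f$ of $X$ (where $R_x(y)=y+x$) is an automorphism of $(X,+)$, and $x\mapsto\mu_x$ is an action of the group $(X,+)$ on $X$. Moreover, with $\beta$ the biadditive mapping associated with $f$, $$a^{3i}x\cdot ya^{3j}=a^{3(i+j)}\Big(f^{-3j}(x)+f^{-3j}(y)+\sum_{k\in I(-2j,i)}f^{-3k}(\beta(x,y))\Big),$$ $$a^{3i}x\cdot a^{3j}y=a^{3(i+j)}\Big(f^{-3j}(x)+y+\sum_{k\in I(i+j,-j)}f^{-3k}(\beta(x,y))\Big)$$ for all $i,j\in\mathbb Z$ and all $x,y\in X$. -/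

import Mathlib

/-- A loop: a set with a multiplication and a two-sided identity element `1` such that all left
and all right translations are permutations. No associativity is assumed. -/
class AlgLoop (Q : Type*) extends MulOneClass Q where
  left_bijective : ∀ x : Q, Function.Bijective (fun y : Q => x * y)
  right_bijective : ∀ x : Q, Function.Bijective (fun y : Q => y * x)

namespace AlgLoop

/-- The left translation `L_x`, `L_x(y) = x * y`. -/
noncomputable def L {Q : Type*} [AlgLoop Q] (x : Q) : Equiv.Perm Q :=
  Equiv.ofBijective (fun y => x * y) (AlgLoop.left_bijective x)

/-- The right translation `R_x`, `R_x(y) = y * x`. -/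
noncomputable def R {Q : Type*} [AlgLoop Q] (x : Q) : Equiv.Perm Q :=
  Equiv.ofBijective (fun y => y * x) (AlgLoop.right_bijective x)

/-- The conjugation `T_x = R_x⁻¹ L_x` (products of permutations are compositions), that is,
`T_x(y)` is the unique element with `T_x(y) * x = x * y`. -/
noncomputable def T {Q : Type*} [AlgLoop Q] (x : Q) : Equiv.Perm Q := (R x)⁻¹ * L x

/-- The integer power `a ^ n`, as `L_a ^ n` applied to `1`. In a power associative loop (such as a
Moufang loop) all reasonable definitions of powers agree. -/
noncomputable def pow {Q : Type*} [AlgLoop Q] (a : Q) (n : ℤ) : Q := (L a ^ n) 1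

/-- The multiplication group, generated by all left and right translations. -/
def Mlt (Q : Type*) [AlgLoop Q] : Subgroup (Equiv.Perm Q) :=
  Subgroup.closure (Set.range (L (Q := Q)) ∪ Set.range (R (Q := Q)))

/-- The inner mapping group, the stabilizer of `1` in the multiplication group. -/
def Inn (Q : Type*) [AlgLoop Q] : Subgroup (Equiv.Perm Q) :=
  Mlt Q ⊓ MulAction.stabilizer (Equiv.Perm Q) (1 : Q)

/-- A loop is Moufang if it satisfies the Moufang identity `xy · zx = (x · yz) x`. -/
def IsMoufang (Q : Type*) [AlgLoop Q] : Prop :=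
  ∀ x y z : Q, (x * y) * (z * x) = (x * (y * z)) * x

theorem T_mem_Inn {Q : Type*} [AlgLoop Q] (a : Q) : T a ∈ Inn Q := by
  refine Subgroup.mem_inf.2 ⟨?_, ?_⟩
  · exact mul_mem (inv_mem (Subgroup.subset_closure (Or.inr ⟨a, rfl⟩)))
      (Subgroup.subset_closure (Or.inl ⟨a, rfl⟩))
  · rw [MulAction.mem_stabilizer_iff, Equiv.Perm.smul_def]
    change (R a).symm (a * 1) = 1
    rw [Equiv.symm_apply_eq]
    change a * 1 = 1 * a
    rw [mul_one, one_mul]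

end AlgLoop

/-- A subloop: a subset containing `1`, closed under multiplication and both divisions. -/
structure Subloop (Q : Type*) [AlgLoop Q] where
  carrier : Set Q
  one_mem : (1 : Q) ∈ carrier
  mul_mem : ∀ {x y : Q}, x ∈ carrier → y ∈ carrier → x * y ∈ carrier
  ldiv_mem : ∀ {x y : Q}, x ∈ carrier → y ∈ carrier → (AlgLoop.L x).symm y ∈ carrier
  rdiv_mem : ∀ {x y : Q}, x ∈ carrier → y ∈ carrier → (AlgLoop.R x).symm y ∈ carrier

/-- A subloop is normal if every inner mapping of the loop maps it onto itself. -/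
def Subloop.IsNormal {Q : Type*} [AlgLoop Q] (X : Subloop Q) : Prop :=
  ∀ φ ∈ AlgLoop.Inn Q, φ '' X.carrier = X.carrier

/-- An abelian subgroup of a loop: an associative and commutative subloop. -/
structure AbelianSubgroup (Q : Type*) [AlgLoop Q] extends Subloop Q where
  assoc : ∀ x ∈ carrier, ∀ y ∈ carrier, ∀ z ∈ carrier, (x * y) * z = x * (y * z)
  comm : ∀ x ∈ carrier, ∀ y ∈ carrier, x * y = y * x

namespace AbelianSubgroup

instance {Q : Type*} [AlgLoop Q] : CoeSort (AbelianSubgroup Q) (Type _) :=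
  ⟨fun X => {x : Q // x ∈ X.carrier}⟩

/-- The sum of two elements of `X` is their product in the loop. -/
instance instAdd {Q : Type*} [AlgLoop Q] (X : AbelianSubgroup Q) : Add X :=
  ⟨fun x y => ⟨(x : Q) * (y : Q), X.mul_mem x.2 y.2⟩⟩

/-- The zero of `X` is the identity element of the loop. -/
instance instZero {Q : Type*} [AlgLoop Q] (X : AbelianSubgroup Q) : Zero X :=
  ⟨⟨1, X.one_mem⟩⟩

/-- The negative of `x` is the solution `y` of `x * y = 1`. -/
noncomputable instance instNeg {Q : Type*} [AlgLoop Q] (X : AbelianSubgroup Q) : Neg X :=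
  ⟨fun x => ⟨(AlgLoop.L (x : Q)).symm 1, X.ldiv_mem x.2 X.one_mem⟩⟩

/-- The abelian group `(X, +)`: the restriction of the multiplication of the loop to `X`,
written additively. -/
noncomputable instance instAddCommGroup {Q : Type*} [AlgLoop Q] (X : AbelianSubgroup Q) :
    AddCommGroup X where
  add_assoc x y z := Subtype.ext (X.assoc x x.2 y y.2 z z.2)
  zero_add x := Subtype.ext (one_mul (x : Q))
  add_zero x := Subtype.ext (mul_one (x : Q))
  add_comm x y := Subtype.ext (X.comm x x.2 y y.2)
  neg_add_cancel x := Subtype.ext (by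
    change (AlgLoop.L (x : Q)).symm 1 * (x : Q) = 1
    rw [X.comm _ (X.ldiv_mem x.2 X.one_mem) _ x.2]
    exact (AlgLoop.L (x : Q)).apply_symm_apply 1)
  nsmul := nsmulRec
  zsmul := zsmulRec

theorem T_mem_iff {Q : Type*} [AlgLoop Q] (X : AbelianSubgroup Q) (hX : X.toSubloop.IsNormal)
    (a x : Q) : AlgLoop.T a x ∈ X.carrier ↔ x ∈ X.carrier := by
  have h := hX _ (AlgLoop.T_mem_Inn a)
  constructor
  · intro hx
    rw [← h] at hx
    obtain ⟨y, hy, hyx⟩ := hx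
    exact (AlgLoop.T a).injective hyx ▸ hy
  · intro hx
    rw [← h]
    exact ⟨x, hx, rfl⟩

/-- The restriction of the conjugation `T_a` to a normal abelian subgroup `X`. -/
noncomputable def conj {Q : Type*} [AlgLoop Q] (X : AbelianSubgroup Q)
    (hX : X.toSubloop.IsNormal) (a : Q) : Equiv.Perm X :=
  (AlgLoop.T a).subtypePerm (X.T_mem_iff hX a)

end AbelianSubgroup

/-- `β(x, y) = f⁻¹(f(x) + f(y)) - x - y`. -/
def moufangBeta {X : Type*} [AddCommGroup X] (f : Equiv.Perm X) (x y : X) : X :=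
  f.symm (f x + f y) - x - y

/-- A permutation `f` of an abelian group is a Moufang permutation if the mapping
`β(x, y) = f⁻¹(f(x) + f(y)) - x - y` is symmetric, alternating and biadditive,
`β(β(x, y), z) = 0` and `β(f(x), f(y)) = f(β(f³(x), y))`. -/
structure IsMoufangPerm {X : Type*} [AddCommGroup X] (f : Equiv.Perm X) : Prop where
  symmetric : ∀ x y, moufangBeta f x y = moufangBeta f y x
  alternating : ∀ x, moufangBeta f x x = 0
  add_left : ∀ x y z, moufangBeta f (x + y) z = moufangBeta f x z + moufangBeta f y z
  add_right : ∀ x y z, moufangBeta f x (y + z) = moufangBeta f x y + moufangBeta f x z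
  radical : ∀ x y z, moufangBeta f (moufangBeta f x y) z = 0
  twist : ∀ x y, moufangBeta f (f x) (f y) = f (moufangBeta f ((f ^ 3) x) y)

/-- The permutation `μ_x = R_x⁻¹ f⁻¹ R_{f(x)} f` of an abelian group (products are compositions,
`R_x(y) = y + x`). -/
def moufangMu {X : Type*} [AddCommGroup X] (f : Equiv.Perm X) (x : X) : Equiv.Perm X :=
  (Equiv.addRight x)⁻¹ * f⁻¹ * Equiv.addRight (f x) * f

/-- The interval `I(i, j)` of integers: empty if `i = j`, `{i, …, j - 1}` if `i < j`, and
`{j, …, i - 1}` if `j < i`. -/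
noncomputable def intInterval (i j : ℤ) : Finset ℤ :=
  if i ≤ j then Finset.Ico i j else Finset.Ico j i

/-! ### Autotopisms and powers in Moufang loops. -/

namespace AlgLoop

variable {Q : Type*} [AlgLoop Q]

/-! Besides (L_x, R_x, L_x R_x), a Moufang loop has the autotopisms (T_a, R_a³T_a, R_a³T_a) and
(L_a⁻³T_a, T_a, L_a⁻³T_a), so conjugation by a interacts with cubes of a. Define α_c(x, y) in X by
x(yc) = (x + y + α_c(x, y))c. Inner mappings with companion in X are additive on X, which makes α_c
biadditive; left alternativity gives α_c(x, x) = 0. Applying the inverse of the first T_a autotopism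
to x · yaⁿ relates α for aⁿ to α for aⁿ⁻³: n = 0 identifies β with α for a⁻³, and n = -3 ties β to α
for a⁻⁶. The Moufang identity with third factor za⁻³ links the same two maps again; eliminating α
for a⁻⁶ yields the radical and twist laws (`deviation_radical_and_twist`).

For the product formulas, autotopisms reduce a³ⁱx · ya³ʲ to a power of a times f^(-i-2j)(f^(i-j)(x)
+ f^(i-j)(y)) (`L_zpow_mul_R_zpow`). It remains to expand a power of f on a sum (`zpow_apply_add`).
Since 2β = 0, signs are irrelevant and unoriented intervals suffice. -/

@[simp] theorem L_apply (x y : Q) : L x y = x * y := rfl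

@[simp] theorem R_apply (x y : Q) : R x y = y * x := rfl

/-- An autotopism: a triple of permutations with `A u * B v = C (u * v)`. -/
def IsAutotopism (A B C : Equiv.Perm Q) : Prop := ∀ u v : Q, A u * B v = C (u * v)

theorem IsAutotopism.one : IsAutotopism (1 : Equiv.Perm Q) 1 1 := fun _ _ => rfl

theorem IsAutotopism.mul {A B C A' B' C' : Equiv.Perm Q} (h : IsAutotopism A B C)
    (h' : IsAutotopism A' B' C') : IsAutotopism (A * A') (B * B') (C * C') := fun u v => by
  simp only [Equiv.Perm.mul_apply]
  rw [h, h']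

theorem IsAutotopism.inv {A B C : Equiv.Perm Q} (h : IsAutotopism A B C) :
    IsAutotopism A⁻¹ B⁻¹ C⁻¹ := fun u v => by
  rw [Equiv.Perm.eq_inv_iff_eq, ← h]
  simp

theorem IsAutotopism.zpow {A B C : Equiv.Perm Q} (h : IsAutotopism A B C) (n : ℤ) :
    IsAutotopism (A ^ n) (B ^ n) (C ^ n) := by
  induction n using Int.induction_on with
  | zero => simpa using IsAutotopism.one
  | succ n ih => simpa only [zpow_add_one] using ih.mul h
  | pred n ih => simpa only [zpow_sub_one] using ih.mul h.inv

theorem IsMoufang.commute_L_R (hQ : IsMoufang Q) (x : Q) : Commute (L x) (R x) := by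
  ext z
  simpa using hQ x 1 z

theorem IsMoufang.autotopism_middle (hQ : IsMoufang Q) (x : Q) :
    IsAutotopism (L x) (R x) (L x * R x) := fun u v => by
  rw [(hQ.commute_L_R x).eq]
  exact hQ x u v

/-- The inverse of `x`, the solution `y` of `x * y = 1`. -/
noncomputable def rinv (x : Q) : Q := (L x)⁻¹ 1

theorem mul_rinv (x : Q) : x * rinv x = 1 := Equiv.apply_symm_apply (L x) 1

theorem IsMoufang.L_rinv (hQ : IsMoufang Q) (x : Q) : L (rinv x) = (L x)⁻¹ := by
  rw [eq_inv_iff_mul_eq_one, mul_eq_one_iff_eq_inv, eq_comm, inv_eq_iff_mul_eq_one]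
  ext z
  apply (R x).injective
  simpa [mul_rinv] using (hQ x (rinv x) z).symm

theorem IsMoufang.rinv_mul (hQ : IsMoufang Q) (x : Q) : rinv x * x = 1 := by
  have h := congrArg (fun p : Equiv.Perm Q => p x) (hQ.L_rinv x)
  simp only [L_apply] at h
  rw [h, Equiv.Perm.inv_eq_iff_eq, L_apply, mul_one]

theorem IsMoufang.R_rinv (hQ : IsMoufang Q) (x : Q) : R (rinv x) = (R x)⁻¹ := by
  rw [eq_comm, inv_eq_iff_mul_eq_one]
  ext z
  apply (L x).injective
  have h := hQ x z (rinv x)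
  have h' := congrArg (fun p : Equiv.Perm Q => p (z * rinv x)) (hQ.commute_L_R x).eq
  simp only [Equiv.Perm.mul_apply, L_apply, R_apply] at h'
  rw [hQ.rinv_mul, mul_one] at h
  simpa [h'] using h.symm

theorem IsMoufang.rinv_mul_cancel_left (hQ : IsMoufang Q) (x y : Q) :
    rinv x * (x * y) = y := by
  have h := congrArg (fun p : Equiv.Perm Q => p (x * y)) (hQ.L_rinv x)
  simp only [L_apply] at h
  rw [h, Equiv.Perm.inv_eq_iff_eq, L_apply]

theorem IsMoufang.mul_rinv_cancel_right (hQ : IsMoufang Q) (x y : Q) :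
    (y * x) * rinv x = y := by
  have h := congrArg (fun p : Equiv.Perm Q => p (y * x)) (hQ.R_rinv x)
  simp only [R_apply] at h
  rw [h, Equiv.Perm.inv_eq_iff_eq, R_apply]

theorem IsMoufang.rinv_rinv (hQ : IsMoufang Q) (x : Q) : rinv (rinv x) = x := by
  apply (L (rinv x)).injective
  simp only [L_apply]
  rw [mul_rinv, hQ.rinv_mul]

theorem IsMoufang.rinv_mul_rev (hQ : IsMoufang Q) (x y : Q) :
    rinv (x * y) = rinv y * rinv x := by
  have h : rinv y = rinv (x * y) * x := by
    have h' := hQ.rinv_mul_cancel_left (x * y) (rinv y)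
    rwa [hQ.mul_rinv_cancel_right, eq_comm] at h'
  rw [h, hQ.mul_rinv_cancel_right]

/-- The autotopism expressing the right Moufang identity. -/
theorem IsMoufang.autotopism_right (hQ : IsMoufang Q) (x : Q) :
    IsAutotopism (R x)⁻¹ (L x * R x) (R x) := fun u v => by
  -- This reads (xu⁻¹)((uv)x) = x(vx); the factor xu⁻¹ is the inverse of ux⁻¹ and cancels.
  have h := hQ.autotopism_middle x (rinv u) (u * v)
  rw [hQ.rinv_mul_cancel_left] at h
  rw [← h, ← hQ.R_rinv]
  simp only [L_apply, R_apply]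
  rw [← hQ.rinv_rinv (u * rinv x), hQ.rinv_mul_rev, hQ.rinv_rinv, hQ.rinv_mul_cancel_left]

/-- The autotopism expressing the left Moufang identity. -/
theorem IsMoufang.autotopism_left (hQ : IsMoufang Q) (x : Q) :
    IsAutotopism (L x * R x) (L x)⁻¹ (L x) := fun u v => by
  have h := hQ.autotopism_middle x (u * v) (rinv v)
  rw [hQ.mul_rinv_cancel_right] at h
  rw [← h, ← hQ.L_rinv]
  simp only [L_apply, R_apply]
  rw [← hQ.rinv_rinv (rinv x * v), hQ.rinv_mul_rev, hQ.rinv_rinv, hQ.mul_rinv_cancel_right]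

theorem IsMoufang.commute_T_L (hQ : IsMoufang Q) (x : Q) : Commute (T x) (L x) :=
  Commute.mul_left (hQ.commute_L_R x).symm.inv_left (Commute.refl _)

theorem IsMoufang.commute_T_R (hQ : IsMoufang Q) (x : Q) : Commute (T x) (R x) :=
  Commute.mul_left (Commute.refl _).inv_left (hQ.commute_L_R x)

theorem IsMoufang.L_zpow_eq (hQ : IsMoufang Q) (x : Q) (n : ℤ) :
    L x ^ n = R x ^ n * T x ^ n := by
  rw [← (hQ.commute_T_R x).symm.mul_zpow, T, mul_inv_cancel_left]

/-- `T x` is a pseudo-automorphism with right companion `x ^ 3`. -/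
theorem IsMoufang.autotopism_T_right (hQ : IsMoufang Q) (x : Q) :
    IsAutotopism (T x) (R x ^ (3 : ℤ) * T x) (R x ^ (3 : ℤ) * T x) := by
  have h := (hQ.autotopism_right x).mul (hQ.autotopism_middle x)
  have hc := hQ.commute_L_R x
  have e : R x ^ (3 : ℤ) * T x = R x * (L x * R x) := by
    rw [T, show (3 : ℤ) = 1 + 1 + 1 by norm_num, zpow_add, zpow_add, zpow_one, hc.eq]
    simp only [mul_assoc]
    rw [mul_inv_cancel_left]
  have e' : R x * (L x * R x) = L x * (R x * R x) := by rw [← mul_assoc, ← hc.eq, mul_assoc]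
  rw [e, e']
  rw [mul_assoc, ← mul_assoc (R x), ← hc.eq, mul_assoc, ← T] at h
  exact h

/-- `T x` is a pseudo-automorphism with left companion `x ^ (-3)`. -/
theorem IsMoufang.autotopism_T_left (hQ : IsMoufang Q) (x : Q) :
    IsAutotopism (L x ^ (-3 : ℤ) * T x) (T x) (L x ^ (-3 : ℤ) * T x) := by
  have h := (hQ.autotopism_middle x).inv.mul (hQ.autotopism_left x).inv
  have hc := hQ.commute_L_R x
  have hc' : Commute (L x)⁻¹ (R x)⁻¹ := hc.inv_left.inv_right
  have e : L x ^ (-3 : ℤ) * T x = (R x)⁻¹ * (L x)⁻¹ * (L x)⁻¹ := by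
    rw [show (-3 : ℤ) = -1 + -1 + -1 by norm_num, zpow_add, zpow_add, zpow_neg_one, T,
      ← hc.inv_right.eq, mul_assoc, inv_mul_cancel_left, mul_assoc, hc'.eq, ← mul_assoc, hc'.eq]
  rw [e]
  convert h using 1
  · rw [mul_inv_rev, ← mul_assoc, hc'.eq]
  · rw [T, inv_inv]
  · rw [mul_inv_rev]

theorem IsMoufang.L_zpow_mul_apply (hQ : IsMoufang Q) (x u : Q) (n : ℤ) :
    L (((L x * R x) ^ n) u) = L x ^ n * L u * L x ^ n := by
  ext v
  have h := (hQ.autotopism_left x).zpow n u ((L x ^ n) v)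
  rw [inv_zpow, Equiv.Perm.coe_inv, Equiv.symm_apply_apply] at h
  simpa using h

theorem IsMoufang.R_zpow_mul_apply (hQ : IsMoufang Q) (x v : Q) (n : ℤ) :
    R (((L x * R x) ^ n) v) = R x ^ n * R v * R x ^ n := by
  ext u
  have h := (hQ.autotopism_right x).zpow n ((R x ^ n) u) v
  rw [inv_zpow, Equiv.Perm.coe_inv, Equiv.symm_apply_apply] at h
  simpa using h

@[simp] theorem L_one : L (1 : Q) = 1 := by ext; simp

@[simp] theorem R_one : R (1 : Q) = 1 := by ext; simp

theorem IsMoufang.pow_even (hQ : IsMoufang Q) (a : Q) (n : ℤ) :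
    pow a (n + n) = ((L a * R a) ^ n) 1 := by
  have h := congrArg (fun p : Equiv.Perm Q => p 1) (hQ.L_zpow_mul_apply a 1 n)
  simp only [L_apply, mul_one, L_one] at h
  rw [h, pow, zpow_add]

theorem IsMoufang.pow_odd (hQ : IsMoufang Q) (a : Q) (n : ℤ) :
    pow a (n + 1 + n) = ((L a * R a) ^ n) a := by
  have h := congrArg (fun p : Equiv.Perm Q => p 1) (hQ.L_zpow_mul_apply a a n)
  simp only [L_apply, mul_one] at h
  rw [h, pow, zpow_add, zpow_add_one]

/-- Each L_a R_a raises the exponent by two, so the seeds 1 and a reach the even and the odd powers.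
-/
theorem IsMoufang.L_pow (hQ : IsMoufang Q) (a : Q) (n : ℤ) : L (pow a n) = L a ^ n := by
  obtain ⟨k, rfl | rfl⟩ := Int.even_or_odd' n
  · rw [two_mul, hQ.pow_even, hQ.L_zpow_mul_apply, L_one, mul_one, zpow_add]
  · rw [show 2 * k + 1 = k + 1 + k by ring, hQ.pow_odd, hQ.L_zpow_mul_apply, zpow_add,
      zpow_add_one]

theorem IsMoufang.R_pow (hQ : IsMoufang Q) (a : Q) (n : ℤ) : R (pow a n) = R a ^ n := by
  obtain ⟨k, rfl | rfl⟩ := Int.even_or_odd' n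
  · rw [two_mul, hQ.pow_even, hQ.R_zpow_mul_apply, R_one, mul_one, zpow_add]
  · rw [show 2 * k + 1 = k + 1 + k by ring, hQ.pow_odd, hQ.R_zpow_mul_apply, zpow_add,
      zpow_add_one]

theorem IsMoufang.R_conj_L (hQ : IsMoufang Q) (c x : Q) :
    R c * L x * (R c)⁻¹ = (L c)⁻¹ * L (c * x) := by
  rw [mul_inv_eq_iff_eq_mul, mul_assoc, eq_inv_mul_iff_mul_eq]
  ext v
  exact (hQ.autotopism_middle c x v).symm

theorem L_mem_Mlt (x : Q) : L x ∈ Mlt Q := Subgroup.subset_closure (Or.inl ⟨x, rfl⟩)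

theorem R_mem_Mlt (x : Q) : R x ∈ Mlt Q := Subgroup.subset_closure (Or.inr ⟨x, rfl⟩)

theorem mem_Inn {p : Equiv.Perm Q} (hp : p ∈ Mlt Q) (h : p 1 = 1) : p ∈ Inn Q :=
  Subgroup.mem_inf.2 ⟨hp, h⟩

end AlgLoop

/-! ### The associativity defect on a normal abelian subgroup. -/

namespace AbelianSubgroup
open AlgLoop
variable {Q : Type*} [AlgLoop Q] (X : AbelianSubgroup Q)

@[simp] theorem coe_add (x y : X) : ((x + y : X) : Q) = (x : Q) * (y : Q) := rfl

variable {X}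

theorem Inn_mem (hX : X.toSubloop.IsNormal) {p : Equiv.Perm Q} (hp : p ∈ Inn Q) {x : Q}
    (hx : x ∈ X.carrier) : p x ∈ X.carrier := by
  rw [← hX p hp]
  exact ⟨x, hx, rfl⟩

/-- L_x⁻¹ R_c⁻¹ L_x R_c fixes 1, so it is inner and preserves X. -/
theorem rdiv_mem_carrier (hX : X.toSubloop.IsNormal) (c : Q) (x y : X) :
    (R c)⁻¹ ((x : Q) * ((y : Q) * c)) ∈ X.carrier := by
  have h : ((L (x : Q))⁻¹ * (R c)⁻¹ * L (x : Q) * R c) (y : Q) ∈ X.carrier := by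
    refine X.Inn_mem hX (mem_Inn ?_ ?_) y.2
    · exact mul_mem (mul_mem (mul_mem (inv_mem (L_mem_Mlt _)) (inv_mem (R_mem_Mlt _)))
        (L_mem_Mlt _)) (R_mem_Mlt _)
    · rw [Equiv.Perm.mul_apply, Equiv.Perm.mul_apply, Equiv.Perm.mul_apply,
        Equiv.Perm.inv_eq_iff_eq, Equiv.Perm.inv_eq_iff_eq]
      simp
  have h' := X.mul_mem x.2 h
  rw [← AlgLoop.L_apply] at h'
  simpa using h'

/-- The element `z` of `X` with `x * (y * c) = z * c`. -/
noncomputable def shiftedAdd (hX : X.toSubloop.IsNormal) (c : Q) (x y : X) : X :=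
  ⟨(R c)⁻¹ ((x : Q) * ((y : Q) * c)), rdiv_mem_carrier hX c x y⟩

/-- The defect `α(x, y)` in `x * (y * c) = (x + y + α(x, y)) * c`. -/
noncomputable def associatorMap (hX : X.toSubloop.IsNormal) (c : Q) (x y : X) : X :=
  shiftedAdd hX c x y - x - y

theorem mul_mul_eq (hX : X.toSubloop.IsNormal) (c : Q) (x y : X) :
    (x : Q) * ((y : Q) * c) = ((x + y + associatorMap hX c x y : X) : Q) * c := by
  have h : x + y + associatorMap hX c x y = shiftedAdd hX c x y := by
    rw [associatorMap]; abel
  rw [h]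
  exact (Equiv.apply_symm_apply (R c) _).symm

theorem eq_of_coe_mul_eq {c : Q} {x y : X} (h : (x : Q) * c = (y : Q) * c) : x = y :=
  Subtype.ext ((R c).injective h)

theorem associatorMap_self (hQ : IsMoufang Q) (hX : X.toSubloop.IsNormal) (c : Q) (x : X) :
    associatorMap hX c x x = 0 := by
  -- Left alternativity: (xx)c = x(xc).
  have h := congrArg (fun p : Equiv.Perm Q => p c) (hQ.L_zpow_mul_apply (x : Q) 1 1)
  simp only [zpow_one, L_one, Equiv.Perm.mul_apply, AlgLoop.R_apply, AlgLoop.L_apply,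
    Equiv.Perm.one_apply, one_mul] at h
  rw [mul_mul_eq hX, ← coe_add] at h
  simpa using (eq_of_coe_mul_eq h).symm

/-- An autotopism of a loop whose first component fixes `1` and preserves `X`, and whose
second component sends `1` to `X`, is additive on `X` in its first component. -/
theorem map_add_of_autotopism_left {A B C : Equiv.Perm Q} (h : IsAutotopism A B C)
    (hA : A 1 = 1) (hm : ∀ x ∈ X.carrier, A x ∈ X.carrier) (hB : B 1 ∈ X.carrier) {x y : Q}
    (hx : x ∈ X.carrier) (hy : y ∈ X.carrier) : A (x * y) = A x * A y := by
  have hBC : ∀ v, B v = C v := fun v => by simpa [hA] using h 1 v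
  have hB' : ∀ u, B u = A u * B 1 := fun u => by rw [h, hBC, mul_one]
  apply (R (B 1)).injective
  simp only [AlgLoop.R_apply]
  rw [← hB', hBC, ← h, hB' y, X.assoc _ (hm x hx) _ (hm y hy) _ hB]

theorem map_add_of_autotopism_right {A B C : Equiv.Perm Q} (h : IsAutotopism A B C)
    (hB : B 1 = 1) (hm : ∀ x ∈ X.carrier, B x ∈ X.carrier) (hA : A 1 ∈ X.carrier) {x y : Q}
    (hx : x ∈ X.carrier) (hy : y ∈ X.carrier) : B (x * y) = B x * B y := by
  have hAC : ∀ v, A v = C v := fun v => by simpa [hB] using h v 1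
  have hA' : ∀ u, A u = A 1 * B u := fun u => by rw [h, hAC, one_mul]
  apply (L (A 1)).injective
  simp only [AlgLoop.L_apply]
  rw [← hA', hAC, ← h, hA' x, X.assoc _ hA _ (hm x hx) _ (hm y hy)]

end AbelianSubgroup

/-! ### The algebraic core. -/

/-- The algebraic core: a permutation `f` whose deviation `g` from additivity is biadditive and
alternating, and that is compatible with the Moufang identity, makes `g` vanish on its image. -/
theorem deviation_radical_and_twist {X : Type*} [AddCommGroup X] (f : Equiv.Perm X)
    (g h : X → X → X)
    (gl : ∀ x y z, g (x + y) z = g x z + g y z) (gr : ∀ x y z, g x (y + z) = g x y + g x z)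
    (hl : ∀ x y z, h (x + y) z = h x z + h y z) (gxx : ∀ x, g x x = 0)
    (hg : ∀ x y, f (x + y) = f x + f y + g (f x) (f y))
    (hh : ∀ x y, f (x + y + g x y) = f x + f y + h (f x) (f y))
    (hm : ∀ x y z, (x + y) + (z + (f ^ 3) x + h z ((f ^ 3) x)) +
        g (x + y) (z + (f ^ 3) x + h z ((f ^ 3) x)) =
      (x + (y + z + g y z) + g x (y + z + g y z)) + (f ^ 3) x +
        h (x + (y + z + g y z) + g x (y + z + g y z)) ((f ^ 3) x)) :
    (∀ x y, g x y = g y x) ∧ (∀ x y z, g (g x y) z = 0) ∧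
      ∀ x y, f (g x ((f ^ 3) y)) = g (f x) (f y) := by
  have gz : ∀ x, g 0 x = 0 := fun x => by simpa using gl 0 0 x
  have gz' : ∀ x, g x 0 = 0 := fun x => by simpa using gr x 0 0
  have hz : ∀ x, h 0 x = 0 := fun x => by simpa using hl 0 0 x
  have comm : ∀ x y, g x y = g y x := fun x y => by
    have e1 := hg (f.symm x) (f.symm y)
    have e2 := hg (f.symm y) (f.symm x)
    simp only [Equiv.apply_symm_apply] at e1 e2
    rw [add_comm (f.symm y), e1, add_comm y] at e2
    exact add_left_cancel e2
  have two : ∀ x y, g x y + g x y = 0 := fun x y => by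
    have e := gxx (x + y)
    rw [gl, gr, gr, gxx, gxx, comm y x] at e
    simpa using e
  have neg : ∀ x y, -g x y = g x y := fun x y => neg_eq_of_add_eq_zero_left (two x y)
  -- Expand f of a triple sum under both bracketings.
  have assoc : ∀ x y z, g (g x y) z = g x (g y z) := fun x y z => by
    have e1 : f (f.symm x + f.symm y + f.symm z) =
        x + y + g x y + z + (g x z + g y z + g (g x y) z) := by
      rw [hg, hg]
      simp only [Equiv.apply_symm_apply, gl]
    have e2 : f (f.symm x + (f.symm y + f.symm z)) =
        x + (y + z + g y z) + (g x y + g x z + g x (g y z)) := by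
      rw [hg, hg]
      simp only [Equiv.apply_symm_apply, gr]
    rw [add_assoc (f.symm x), e2] at e1
    have : g x (g y z) - g (g x y) z = 0 := by
      rw [← sub_eq_zero] at e1
      rw [← e1]; abel
    exact (sub_eq_zero.1 this).symm
  have hc : ∀ x y, g y ((f ^ 3) x) = g x y + h y ((f ^ 3) x) + h (g x y) ((f ^ 3) x) ∧
      g x ((f ^ 3) x) = h x ((f ^ 3) x) := fun x y => by
    have e0 := hm x 0 0
    have e1 := hm x y 0
    simp only [gz, gz', hz, gl, hl, add_zero, zero_add] at e0 e1
    have e0' : g x ((f ^ 3) x) = h x ((f ^ 3) x) := by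
      simpa [add_assoc] using e0
    refine ⟨?_, e0'⟩
    rw [e0'] at e1
    rw [← sub_eq_zero] at e1 ⊢
    rw [← e1]; abel
  have hD' : ∀ x y, h (g x y) ((f ^ 3) x) = g (g x y) ((f ^ 3) x) := fun x y => by
    have e := (hc x (g x y)).1
    rw [← assoc x x y, gxx, gz, hz] at e
    rw [e]; abel
  -- This expresses h through g, so that h can be eliminated from the full identity `hm`.
  have hD : ∀ x y, h y ((f ^ 3) x) = g y ((f ^ 3) x) + g x y + g (g x y) ((f ^ 3) x) :=
    fun x y => by
    have e := (hc x y).1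
    rw [hD'] at e
    rw [e, ← sub_eq_zero]
    have e1 := two x y
    have e2 := two (g x y) ((f ^ 3) x)
    calc _ = -(g x y + g x y) - (g (g x y) ((f ^ 3) x) + g (g x y) ((f ^ 3) x)) := by abel
      _ = 0 := by rw [e1, e2]; simp
  have key : ∀ x y z, g x (g y z) = g (g x (g y z)) ((f ^ 3) x) := fun x y z => by
    have e := hm x y z
    simp only [gl, gr, hl] at e
    have a1 : g x (h z ((f ^ 3) x)) = g (g x z) ((f ^ 3) x) := by
      rw [hD, gr, gr, ← assoc x x z, gxx, gz, ← assoc x (g x z), ← assoc x x z, gxx, gz, gz,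
        assoc]
      abel
    have a2 : g y (h z ((f ^ 3) x)) =
        g (g y z) ((f ^ 3) x) + g x (g y z) + g (g x (g y z)) ((f ^ 3) x) := by
      have c : g y (g x z) = g x (g y z) := by rw [← assoc, comm y x, assoc]
      rw [hD, gr, gr, ← assoc y (g x z), c, assoc y]
    rw [a1, a2, hD' x z, hD' x (g y z), hD x (g y z), (hc x y).1, (hc x y).2] at e
    have e5 : -g x (g y z) - g (g x (g y z)) ((f ^ 3) x) = 0 := by
      rw [← sub_eq_zero] at e
      rw [← e]; abel
    rw [neg] at e5
    exact sub_eq_zero.1 e5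
  have rad : ∀ x y z, g (g x y) z = 0 := fun x y z => by
    -- With w = g x (g y z) and F = f³(x), `key` says w = g w F; iterating, w = g (g w F) F = g w (g
    -- F F) = 0.
    rw [assoc, key, key, assoc, gxx, gz']
  refine ⟨comm, rad, fun x y => ?_⟩
  have hcomm : f ((f ^ 3) y) = (f ^ 3) (f y) := rfl
  have rad' : ∀ x y z, g x (g y z) = 0 := fun x y z => by rw [comm, rad]
  have e := hh x ((f ^ 3) y)
  rw [hg, hg, hcomm, hD, rad, add_zero, comm (f y), add_assoc, ← add_assoc _ _ (g (f x) (f y)),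
    add_left_comm, ← sub_eq_zero] at e
  set w := f (g x ((f ^ 3) y))
  set Z := f x + (f ^ 3) (f y) + g (f x) ((f ^ 3) (f y))
  -- It is not yet known that w is a value of g, so `rad` does not kill g Z w directly; applying g Z
  -- to this equation does.
  have e2 : w + g Z w = g (f x) (f y) := by
    rw [← sub_eq_zero, ← e]; abel
  have e3 : g Z w = 0 := by
    have e4 := congrArg (g Z) e2
    rwa [gr, rad', rad', add_zero] at e4
  rw [← e2, e3, add_zero]

/-! ### Sums over unoriented intervals. -/

/-- If q < p, the interval loses q instead of gaining it; for terms with 2t = 0 removal and addition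
agree. -/
theorem sum_intInterval_succ {X : Type*} [AddCommGroup X] (t : ℤ → X)
    (ht : ∀ k, t k + t k = 0) (p q : ℤ) :
    ∑ k ∈ intInterval p (q + 1), t k = ∑ k ∈ intInterval p q, t k + t q := by
  unfold intInterval
  rcases le_or_gt p q with h | h
  · rw [if_pos h, if_pos (by omega), ← Finset.insert_Ico_right_eq_Ico_add_one h,
      Finset.sum_insert (by simp), add_comm]
  · have e : (if p ≤ q + 1 then Finset.Ico p (q + 1) else Finset.Ico (q + 1) p) =
        Finset.Ico (q + 1) p := by
      split_ifs with h'
      · rw [Finset.Ico_eq_empty (by omega), Finset.Ico_eq_empty (by omega)]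
      · rfl
    rw [e, if_neg (by omega), ← Finset.insert_Ico_add_one_left_eq_Ico h,
      Finset.sum_insert (by simp), add_right_comm, ht, zero_add]

theorem intInterval_self (p : ℤ) : intInterval p p = ∅ := by simp [intInterval]

theorem intInterval_comm (p q : ℤ) : intInterval p q = intInterval q p := by
  unfold intInterval
  split_ifs with h h'
  · rw [le_antisymm h h']
  · rfl
  · rfl
  · omega

theorem sum_intInterval_shift {X : Type*} [AddCommGroup X] (t : ℤ → X) (p q m : ℤ) :
    ∑ k ∈ intInterval p q, t (k + m) = ∑ k ∈ intInterval (p + m) (q + m), t k := by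
  refine Finset.sum_bij (fun k _ => k + m) ?_ ?_ ?_ ?_
  · intro k
    simp only [intInterval]
    split_ifs <;> simp only [Finset.mem_Ico] <;> omega
  · intro _ _ _ _ h; simpa using h
  · intro k hk
    refine ⟨k - m, ?_, by simp⟩
    revert hk
    simp only [intInterval]
    split_ifs <;> simp only [Finset.mem_Ico] <;> omega
  · intro _ _; rfl

theorem map_add_of_moufangBeta_eq_zero {X : Type*} [AddCommGroup X] {f : Equiv.Perm X} {x y : X}
    (h : moufangBeta f x y = 0) :
    f (x + y) = f x + f y := by
  rw [moufangBeta, sub_sub, sub_eq_zero, Equiv.symm_apply_eq] at h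
  exact h.symm

theorem map_add_sum_of_moufangBeta_eq_zero {X : Type*} [AddCommGroup X] {f : Equiv.Perm X}
    {ι : Type*} (s : Finset ι) (r : ι → X)
    (hr : ∀ i z, moufangBeta f z (r i) = 0) (x : X) :
    f (x + ∑ i ∈ s, r i) = f x + ∑ i ∈ s, f (r i) := by
  classical
  induction s using Finset.induction_on with
  | empty => simp
  | insert i s hi ih =>
    rw [Finset.sum_insert hi, Finset.sum_insert hi, add_comm (r i), ← add_assoc,
      map_add_of_moufangBeta_eq_zero (hr i _), ih, add_comm (f (r i)), add_assoc]

/-! ### Calculus of Moufang permutations. -/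

namespace IsMoufangPerm

variable {X : Type*} [AddCommGroup X] {f : Equiv.Perm X}

theorem beta_zero_left (hf : IsMoufangPerm f) (x : X) : moufangBeta f 0 x = 0 := by
  simpa using hf.add_left 0 0 x

theorem beta_add_self (hf : IsMoufangPerm f) (x y : X) :
    moufangBeta f x y + moufangBeta f x y = 0 := by
  have e := hf.alternating (x + y)
  rw [hf.add_left, hf.add_right, hf.add_right, hf.alternating, hf.alternating,
    hf.symmetric y x] at e
  simpa using e

theorem apply_beta (hf : IsMoufangPerm f) (x y : X) :
    f (moufangBeta f x y) = moufangBeta f (f x) ((f ^ (-2 : ℤ)) y) := by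
  have h := hf.twist ((f ^ (-3 : ℤ)) y) x
  have e : (f ^ 3) ((f ^ (-3 : ℤ)) y) = y := by
    rw [← zpow_natCast, ← Equiv.Perm.mul_apply, ← zpow_add]; simp
  rw [e, hf.symmetric, hf.symmetric y, ← Equiv.Perm.mul_apply, ← zpow_one_add] at h
  exact h.symm

theorem zpow_apply_beta (hf : IsMoufangPerm f) (n : ℤ) (x y : X) :
    (f ^ n) (moufangBeta f x y) = moufangBeta f ((f ^ n) x) ((f ^ (-2 * n)) y) := by
  have step : ∀ k : ℤ, f (moufangBeta f ((f ^ k) x) ((f ^ (-2 * k)) y)) =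
      moufangBeta f ((f ^ (k + 1)) x) ((f ^ (-2 * (k + 1))) y) := fun k => by
    rw [hf.apply_beta, ← Equiv.Perm.mul_apply, ← Equiv.Perm.mul_apply, ← zpow_one_add,
      ← zpow_add, add_comm 1 k, show -2 + -2 * k = -2 * (k + 1) by ring]
  induction n using Int.induction_on with
  | zero => simp
  | succ n ih => rw [← step, ← ih, add_comm, zpow_one_add, Equiv.Perm.mul_apply]
  | pred n ih =>
    apply f.injective
    rw [step, ← Equiv.Perm.mul_apply, ← zpow_one_add, add_sub_cancel, ih, sub_add_cancel]

/-- Comparing the twist law at (x, y) and (y, x) shows that f³ is self-adjoint for β. -/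
theorem beta_zpow_left (hf : IsMoufangPerm f) (n : ℤ) (x y : X) :
    moufangBeta f ((f ^ (3 * n)) x) y = moufangBeta f x ((f ^ (3 * n)) y) := by
  have step : ∀ x y, moufangBeta f ((f ^ (3 : ℤ)) x) y = moufangBeta f x ((f ^ (3 : ℤ)) y) :=
    fun x y => by
    have h := hf.twist x y
    have h' := hf.twist y x
    rw [hf.symmetric (f y), h, hf.symmetric _ x] at h'
    exact f.injective h'
  induction n using Int.induction_on generalizing x y with
  | zero => simp
  | succ n ih =>
    rw [mul_add, mul_one, zpow_add, Equiv.Perm.mul_apply, ih, step, ← Equiv.Perm.mul_apply,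
      ← zpow_add, ← zpow_add, add_comm]
  | pred n ih =>
    have e : y = (f ^ (3 : ℤ)) ((f ^ (-3 : ℤ)) y) := by
      rw [← Equiv.Perm.mul_apply, ← zpow_add]; simp
    conv_lhs => rw [e]
    rw [← step, ← Equiv.Perm.mul_apply, ← zpow_add, show 3 + 3 * (-(n : ℤ) - 1) = 3 * -n by ring,
      ih, ← Equiv.Perm.mul_apply, ← zpow_add, show 3 * -(n : ℤ) + -3 = 3 * (-n - 1) by ring]

theorem beta_zpow_right (hf : IsMoufangPerm f) (n : ℤ) (x y : X) :
    moufangBeta f x ((f ^ (3 * n)) y) = (f ^ (-3 * n)) (moufangBeta f x y) := by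
  rw [hf.zpow_apply_beta, show -3 * n = 3 * (-n) by ring, hf.beta_zpow_left,
    ← Equiv.Perm.mul_apply, ← zpow_add, show 3 * -n + -2 * (3 * -n) = 3 * n by ring]

theorem beta_zpow_zpow (hf : IsMoufangPerm f) (m : ℤ) (x y : X) :
    moufangBeta f ((f ^ m) x) ((f ^ m) y) = (f ^ (-2 * m)) (moufangBeta f x y) := by
  rw [hf.zpow_apply_beta, show -2 * (-2 * m) = 3 * m + m by ring, zpow_add,
    Equiv.Perm.mul_apply, ← hf.beta_zpow_left, ← Equiv.Perm.mul_apply, ← zpow_add,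
    show 3 * m + -2 * m = m by ring]

theorem zpow_apply_beta_add_self (hf : IsMoufangPerm f) (n : ℤ) (x y : X) :
    (f ^ n) (moufangBeta f x y) + (f ^ n) (moufangBeta f x y) = 0 := by
  rw [hf.zpow_apply_beta, hf.beta_add_self]

theorem beta_zpow_apply_beta (hf : IsMoufangPerm f) (n : ℤ) (x y z : X) :
    moufangBeta f z ((f ^ n) (moufangBeta f x y)) = 0 := by
  rw [hf.zpow_apply_beta, hf.symmetric, hf.radical]

/-- By definition f(x + y + β(x, y)) = f(x) + f(y). As β(x, y) is in the radical, its image splits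
off, and 2f(β(x, y)) = 0 removes the sign. -/
theorem apply_add (hf : IsMoufangPerm f) (x y : X) :
    f (x + y) = f x + f y + f (moufangBeta f x y) := by
  have h : f (x + y + moufangBeta f x y) = f x + f y := by
    rw [moufangBeta, sub_sub, add_sub_cancel, Equiv.apply_symm_apply]
  have h1 := hf.beta_zpow_apply_beta 0 x y (x + y)
  have h2 := hf.zpow_apply_beta_add_self 1 x y
  rw [map_add_of_moufangBeta_eq_zero (by simpa using h1)] at h
  rw [zpow_one] at h2
  rw [← h, add_assoc, h2, add_zero]

/-- Passing from m to m + 1 adds f(β(f^m(x), f^m(y))) = f^(1-2m)(β(x, y)), the term k = m; the older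
terms lie in the radical, where f splits off additively. -/
theorem zpow_apply_add (hf : IsMoufangPerm f) (m : ℤ) (x y : X) :
    (f ^ m) (x + y) = (f ^ m) x + (f ^ m) y +
      ∑ k ∈ intInterval 0 m, (f ^ (m - 3 * k)) (moufangBeta f x y) := by
  have step : ∀ m : ℤ, f ((f ^ m) x + (f ^ m) y +
      ∑ k ∈ intInterval 0 m, (f ^ (m - 3 * k)) (moufangBeta f x y)) =
      (f ^ (m + 1)) x + (f ^ (m + 1)) y +
        ∑ k ∈ intInterval 0 (m + 1), (f ^ (m + 1 - 3 * k)) (moufangBeta f x y) := fun m => by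
    have e : ∀ (k : ℤ) (z : X), f ((f ^ k) z) = (f ^ (k + 1)) z := fun k z => by
      rw [add_comm, zpow_one_add, Equiv.Perm.mul_apply]
    rw [map_add_sum_of_moufangBeta_eq_zero _ _ fun k z => hf.beta_zpow_apply_beta _ x y z,
      sum_intInterval_succ _ fun k => hf.zpow_apply_beta_add_self _ x y, hf.apply_add,
      hf.beta_zpow_zpow, e, e, e, show -2 * m + 1 = m + 1 - 3 * m by ring, add_assoc,
      add_comm _ (Finset.sum _ _)]
    simp only [e, sub_add_eq_add_sub]
  induction m using Int.induction_on with
  | zero => simp [intInterval_self]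
  | succ n ih => rw [← step, ← ih, add_comm, zpow_one_add, Equiv.Perm.mul_apply]
  | pred n ih =>
    apply f.injective
    rw [step, ← Equiv.Perm.mul_apply, ← zpow_one_add, add_sub_cancel, ih, sub_add_cancel]

theorem zpow_apply_zpow_add_zpow (hf : IsMoufangPerm f) (i j : ℤ) (x y : X) :
    (f ^ (-i - 2 * j)) ((f ^ (i - j)) x + (f ^ (i - j)) y) =
      (f ^ (-3 * j)) x + (f ^ (-3 * j)) y +
        ∑ k ∈ intInterval (-2 * j) i, (f ^ (-3 * k)) (moufangBeta f x y) := by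
  -- The exponent (-i-2j) - 3k - 2(i-j) equals -3(k+i), so k is shifted by i.
  rw [hf.zpow_apply_add, hf.beta_zpow_zpow, intInterval_comm (-2 * j),
    show intInterval i (-2 * j) = intInterval (0 + i) (-i - 2 * j + i) by ring_nf,
    ← sum_intInterval_shift]
  simp only [← Equiv.Perm.mul_apply, ← zpow_add]
  congr! 3 with k
  all_goals ring_nf

theorem moufangMu_apply (hf : IsMoufangPerm f) (x y : X) :
    moufangMu f x y = y + moufangBeta f x y := by
  rw [hf.symmetric, moufangBeta]
  simp only [moufangMu, Equiv.Perm.mul_apply, Equiv.Perm.coe_inv, Equiv.coe_addRight,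
    Equiv.addRight_symm]
  abel

end IsMoufangPerm

/-! ### Conjugation restricted to X. -/

namespace AbelianSubgroup
open AlgLoop

variable {Q : Type*} [AlgLoop Q] {X : AbelianSubgroup Q}

/-- With e = c⁻¹ one has R_c⁻¹ L_x R_c = L_e⁻¹ L_{ex}, so y ↦ y + α_c(x, y) is the first component
of a product of middle autotopisms. It is inner, and its companion T_e(x)x⁻¹ is in X. -/
theorem associatorMap_add_right (hQ : IsMoufang Q) (hX : X.toSubloop.IsNormal) (c : Q)
    (x y z : X) :
    associatorMap hX c x (y + z) = associatorMap hX c x y + associatorMap hX c x z := by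
  set e := rinv c
  have h := (hQ.autotopism_middle (x : Q)).inv.mul
    ((hQ.autotopism_middle e).inv.mul (hQ.autotopism_middle (e * x)))
  set A := (L (x : Q))⁻¹ * ((L e)⁻¹ * L (e * x)) with hA
  have hA1 : A 1 = 1 := by
    rw [hA, Equiv.Perm.mul_apply, Equiv.Perm.mul_apply, Equiv.Perm.inv_eq_iff_eq,
      Equiv.Perm.inv_eq_iff_eq]
    simp
  have hm : ∀ u ∈ X.carrier, A u ∈ X.carrier := fun u hu =>
    X.Inn_mem hX (mem_Inn (mul_mem (inv_mem (L_mem_Mlt _)) (mul_mem (inv_mem (L_mem_Mlt _))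
      (L_mem_Mlt _))) hA1) hu
  have hB : ((R (x : Q))⁻¹ * ((R e)⁻¹ * R (e * x))) 1 ∈ X.carrier := by
    have h1 := X.rdiv_mem x.2 (X.Inn_mem hX (T_mem_Inn e) x.2)
    simpa [T] using h1
  have hs : ∀ u : X, shiftedAdd hX c x u = x + ⟨A u, hm u u.2⟩ := fun u => by
    apply Subtype.ext
    have hA' : L (x : Q) * A = (R c)⁻¹ * L (x : Q) * R c := by
      rw [hA, mul_inv_cancel_left, ← hQ.R_conj_L, hQ.R_rinv, inv_inv]
    exact (congrArg (fun p : Equiv.Perm Q => p u) hA').symm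
  have hadd : (⟨A (y + z : X), hm _ (y + z).2⟩ : X) = ⟨A y, hm y y.2⟩ + ⟨A z, hm z z.2⟩ :=
    Subtype.ext (map_add_of_autotopism_left h hA1 hm hB y.2 z.2)
  simp only [associatorMap, hs, hadd]
  abel

/-- Mirror argument: x ↦ x + α_c(x, z) is a second component, with companion z⁻¹T_c⁻¹(z) in X. -/
theorem associatorMap_add_left (hQ : IsMoufang Q) (hX : X.toSubloop.IsNormal) (c : Q)
    (x y z : X) :
    associatorMap hX c (x + y) z = associatorMap hX c x z + associatorMap hX c y z := by
  have h := (hQ.autotopism_middle (z : Q)).inv.mul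
    ((hQ.autotopism_middle c).inv.mul (hQ.autotopism_middle (z * c)))
  set B := (R (z : Q))⁻¹ * ((R c)⁻¹ * R (z * c)) with hB
  have hB1 : B 1 = 1 := by
    rw [hB, Equiv.Perm.mul_apply, Equiv.Perm.mul_apply, Equiv.Perm.inv_eq_iff_eq,
      Equiv.Perm.inv_eq_iff_eq]
    simp
  have hm : ∀ u ∈ X.carrier, B u ∈ X.carrier := fun u hu =>
    X.Inn_mem hX (mem_Inn (mul_mem (inv_mem (R_mem_Mlt _)) (mul_mem (inv_mem (R_mem_Mlt _))
      (R_mem_Mlt _))) hB1) hu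
  have hA : ((L (z : Q))⁻¹ * ((L c)⁻¹ * L (z * c))) 1 ∈ X.carrier := by
    have h1 := X.ldiv_mem z.2 (X.Inn_mem hX (inv_mem (T_mem_Inn c)) z.2)
    simpa [T] using h1
  have hs : ∀ u : X, shiftedAdd hX c u z = ⟨B u, hm u u.2⟩ + z := fun u => by
    apply Subtype.ext
    exact (Equiv.apply_symm_apply (R (z : Q)) _).symm
  have hadd : (⟨B (x + y : X), hm _ (x + y).2⟩ : X) = ⟨B x, hm x x.2⟩ + ⟨B y, hm y y.2⟩ :=
    Subtype.ext (map_add_of_autotopism_right h hB1 hm hA x.2 y.2)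
  simp only [associatorMap, hs, hadd]
  abel

theorem coe_conj_zpow (hX : X.toSubloop.IsNormal) (a : Q) (n : ℤ) (x : X) :
    (((X.conj hX a ^ n) x : X) : Q) = (T a ^ n) x := by
  rw [conj, Equiv.Perm.subtypePerm_zpow]
  rfl

theorem mul_R_zpow (hQ : IsMoufang Q) (hX : X.toSubloop.IsNormal) (a : Q) (n : ℤ) (x y : X) :
    (x : Q) * (R a ^ n) y =
      (R a ^ n) ((x + y + associatorMap hX (pow a n) x y : X) : Q) := by
  simpa [← hQ.R_pow] using mul_mul_eq hX (pow a n) x y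

/-- The inverse of (T_a, R_a³T_a, R_a³T_a), applied to x · yaⁿ, lowers the exponent by 3. -/
theorem conj_inv_add (hQ : IsMoufang Q) (hX : X.toSubloop.IsNormal) (a : Q) (n : ℤ) (x y : X) :
    (X.conj hX a)⁻¹ (x + y + associatorMap hX (pow a n) x y) =
      (X.conj hX a)⁻¹ x + (X.conj hX a)⁻¹ y +
        associatorMap hX (pow a (n - 3)) ((X.conj hX a)⁻¹ x) ((X.conj hX a)⁻¹ y) := by
  have hF : ∀ z : X, (((X.conj hX a)⁻¹ z : X) : Q) = (T a)⁻¹ z := fun z => by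
    simpa using coe_conj_zpow hX a (-1) z
  have h := (hQ.autotopism_T_right a).inv x ((R a ^ n) y)
  have hc := (hQ.commute_T_R a).inv_left
  have e : (R a ^ (3 : ℤ) * T a)⁻¹ * R a ^ n = R a ^ (n - 3) * (T a)⁻¹ := by
    rw [mul_inv_rev, mul_assoc, ← zpow_neg, ← zpow_add, (hc.zpow_right _).eq,
      neg_add_eq_sub]
  rw [mul_R_zpow hQ hX, ← Equiv.Perm.mul_apply, ← Equiv.Perm.mul_apply, e,
    Equiv.Perm.mul_apply, Equiv.Perm.mul_apply, ← hF, ← hF, ← hF, mul_R_zpow hQ hX] at h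
  exact (Subtype.ext ((R a ^ (n - 3)).injective h)).symm

/-- A power of the right Moufang autotopism moves y across aⁿ; the doubled exponent comes from (L_a
R_a)ⁿ = R_a²ⁿ T_aⁿ. -/
theorem R_zpow_mul (hQ : IsMoufang Q) (hX : X.toSubloop.IsNormal) (a : Q) (n : ℤ) (x y : X) :
    (R a ^ n) x * (y : Q) =
      (R a ^ n) ((x + (X.conj hX a ^ n) y +
        associatorMap hX (pow a (2 * n)) x ((X.conj hX a ^ n) y) : X) : Q) := by
  have h := (hQ.autotopism_right a).zpow (-n) x (((L a * R a) ^ n) y)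
  have e : (L a * R a) ^ n = R a ^ (2 * n) * T a ^ n := by
    rw [(hQ.commute_L_R a).mul_zpow, hQ.L_zpow_eq, mul_assoc,
      ((hQ.commute_T_R a).zpow_zpow n n).eq, ← mul_assoc, ← zpow_add, two_mul]
  rw [inv_zpow, zpow_neg, inv_inv, zpow_neg, Equiv.Perm.coe_inv, Equiv.symm_apply_apply, e,
    Equiv.Perm.mul_apply, ← coe_conj_zpow hX, mul_R_zpow hQ hX, ← zpow_neg,
    ← Equiv.Perm.mul_apply, ← zpow_add,
    show -n + 2 * n = n by ring] at h
  exact h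

theorem conj_inv_add_eq (hQ : IsMoufang Q) (hX : X.toSubloop.IsNormal) (a : Q) (x y : X) :
    (X.conj hX a)⁻¹ (x + y) = (X.conj hX a)⁻¹ x + (X.conj hX a)⁻¹ y +
      associatorMap hX (pow a (-3)) ((X.conj hX a)⁻¹ x) ((X.conj hX a)⁻¹ y) := by
  have h := conj_inv_add hQ hX a 0 x y
  have h0 : associatorMap hX (pow a 0) x y = 0 := by
    have h1 := mul_R_zpow hQ hX a 0 x y
    simp only [zpow_zero, Equiv.Perm.one_apply] at h1
    have h2 : x + y = x + y + associatorMap hX (pow a 0) x y := Subtype.ext h1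
    simpa using h2.symm
  rwa [h0, add_zero, zero_sub] at h

theorem moufangBeta_conj (hQ : IsMoufang Q) (hX : X.toSubloop.IsNormal) (a : Q) (x y : X) :
    moufangBeta (X.conj hX a) x y = associatorMap hX (pow a (-3)) x y := by
  have h := conj_inv_add_eq hQ hX a (X.conj hX a x) (X.conj hX a y)
  simp only [Equiv.Perm.coe_inv, Equiv.symm_apply_apply] at h
  rw [moufangBeta, h]
  abel

theorem isMoufangPerm_conj (hQ : IsMoufang Q) (hX : X.toSubloop.IsNormal) (a : Q) :
    IsMoufangPerm (X.conj hX a) := by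
  have gl := associatorMap_add_left hQ hX (pow a (-3))
  have gr := associatorMap_add_right hQ hX (pow a (-3))
  have hβ := moufangBeta_conj hQ hX a
  -- The core is applied to f⁻¹, whose deviation from additivity is α for a⁻³ itself.
  obtain ⟨comm, rad, twist⟩ := deviation_radical_and_twist (X.conj hX a)⁻¹
    (associatorMap hX (pow a (-3))) (associatorMap hX (pow a (-6))) gl gr
    (associatorMap_add_left hQ hX (pow a (-6))) (associatorMap_self hQ hX _)
    (conj_inv_add_eq hQ hX a)
    (fun x y => by simpa using conj_inv_add hQ hX a (-3) x y)
    (fun x y z => by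
      have h := hQ x y ((R a ^ (-3 : ℤ)) z)
      have hψ := fun u : X => R_zpow_mul hQ hX a (-3) u x
      have e : (X.conj hX a) ^ (-3 : ℤ) = (X.conj hX a)⁻¹ ^ 3 := by
        rw [zpow_neg, inv_pow]; rfl
      rw [hψ, ← coe_add, mul_R_zpow hQ hX, mul_R_zpow hQ hX, mul_R_zpow hQ hX, hψ, e] at h
      exact Subtype.ext ((R a ^ (-3 : ℤ)).injective h))
  refine ⟨fun x y => ?_, fun x => ?_, fun x y z => ?_, fun x y z => ?_, fun x y z => ?_,
    fun x y => ?_⟩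
  · rw [hβ, hβ, comm]
  · rw [hβ, associatorMap_self hQ]
  · rw [hβ, hβ, hβ, gl]
  · rw [hβ, hβ, hβ, gr]
  · rw [hβ, hβ, rad]
  · rw [hβ, hβ]
    -- These arguments turn the twist law for f⁻¹ into the one for f.
    have h := twist (X.conj hX a y) ((X.conj hX a ^ 4) x)
    have e1 : ((X.conj hX a)⁻¹ ^ 3) ((X.conj hX a ^ 4) x) = X.conj hX a x := by
      rw [← Equiv.Perm.mul_apply]
      congr 1
      group
    have e2 : (X.conj hX a)⁻¹ ((X.conj hX a ^ 4) x) = (X.conj hX a ^ 3) x := by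
      rw [← Equiv.Perm.mul_apply]
      congr 1
      group
    rw [e1, e2, Equiv.Perm.inv_eq_iff_eq, comm, Equiv.Perm.coe_inv, Equiv.symm_apply_apply,
      comm y] at h
    exact h

/-- A power of the left-companion autotopism of T_a produces a^(3(i-j))x · y; the 3j-th power of
(L_a, R_a, L_a R_a) then supplies the missing a^(3j) on both sides. -/
theorem L_zpow_mul_R_zpow (hQ : IsMoufang Q) (hX : X.toSubloop.IsNormal) (a : Q) (i j : ℤ)
    (x y : X) :
    (L a ^ (3 * i)) x * (R a ^ (3 * j)) y = (L a ^ (3 * (i + j)))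
      (((X.conj hX a ^ (-i - 2 * j)) ((X.conj hX a ^ (i - j)) x + (X.conj hX a ^ (i - j)) y) :
        X) : Q) := by
  have hTL := hQ.commute_T_L a
  have h1 := (hQ.autotopism_T_left a).zpow (-(i - j)) ((T a ^ (i - j)) x) ((T a ^ (i - j)) y)
  have e1 : (L a ^ (-3 : ℤ) * T a) ^ (-(i - j)) = L a ^ (3 * (i - j)) * T a ^ (-(i - j)) := by
    rw [(hTL.symm.zpow_left _).mul_zpow, ← zpow_mul]
    ring_nf
  simp only [e1, ← Equiv.Perm.mul_apply, mul_assoc, ← zpow_add, neg_add_cancel, zpow_zero,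
    mul_one, Equiv.Perm.one_apply] at h1
  have h2 := (hQ.autotopism_middle a).zpow (3 * j) ((L a ^ (3 * (i - j))) x) y
  have e2 : (L a * R a) ^ (3 * j) * L a ^ (3 * (i - j)) * T a ^ (-(i - j)) =
      L a ^ (3 * (i + j)) * T a ^ (-i - 2 * j) := by
    have hR : R a = L a * (T a)⁻¹ := by rw [T, mul_inv_rev, inv_inv, mul_inv_cancel_left]
    have e3 : (L a * R a) ^ (3 * j) = L a ^ (6 * j) * T a ^ (-(3 * j)) := by
      rw [(hQ.commute_L_R a).mul_zpow, hR, hTL.symm.inv_right.mul_zpow, ← mul_assoc, ← zpow_add,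
        inv_zpow, zpow_neg]
      ring_nf
    rw [e3, mul_assoc (L a ^ (6 * j)), (hTL.zpow_zpow _ _).eq, ← mul_assoc, mul_assoc,
      ← zpow_add, ← zpow_add]
    ring_nf
  rw [h1, ← Equiv.Perm.mul_apply, ← Equiv.Perm.mul_apply, ← zpow_add,
    show 3 * j + 3 * (i - j) = 3 * i by ring, ← mul_assoc, e2] at h2
  rw [h2, coe_conj_zpow, coe_add, coe_conj_zpow, coe_conj_zpow, Equiv.Perm.mul_apply]

end AbelianSubgroup

theorem theorem8p1 {Q : Type*} [AlgLoop Q] (hQ : AlgLoop.IsMoufang Q)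
    (X : AbelianSubgroup Q) (hX : X.toSubloop.IsNormal) (a : Q)
    (f : Equiv.Perm X) (hf : f = X.conj hX a) :
    IsMoufangPerm f ∧
    (∀ x y z : X, moufangMu f x (y + z) = moufangMu f x y + moufangMu f x z) ∧
    moufangMu f 0 = 1 ∧
    (∀ x y : X, moufangMu f (x + y) = moufangMu f x * moufangMu f y) ∧
    (∀ (i j : ℤ) (x y : X),
      (AlgLoop.pow a (3 * i) * (x : Q)) * ((y : Q) * AlgLoop.pow a (3 * j)) =
        AlgLoop.pow a (3 * (i + j)) *
          (((f ^ (-3 * j)) x + (f ^ (-3 * j)) y +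
            ∑ k ∈ intInterval (-2 * j) i, (f ^ (-3 * k)) (moufangBeta f x y) : X) : Q)) ∧
    (∀ (i j : ℤ) (x y : X),
      (AlgLoop.pow a (3 * i) * (x : Q)) * (AlgLoop.pow a (3 * j) * (y : Q)) =
        AlgLoop.pow a (3 * (i + j)) *
          (((f ^ (-3 * j)) x + y +
            ∑ k ∈ intInterval (i + j) (-j), (f ^ (-3 * k)) (moufangBeta f x y) : X) : Q)) := by
  subst hf
  have hf := AbelianSubgroup.isMoufangPerm_conj hQ hX a
  have hL : ∀ (n : ℤ) (u : Q), AlgLoop.pow a n * u = (AlgLoop.L a ^ n) u := fun n u => by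
    rw [← hQ.L_pow]; rfl
  have hR : ∀ (n : ℤ) (u : Q), u * AlgLoop.pow a n = (AlgLoop.R a ^ n) u := fun n u => by
    rw [← hQ.R_pow]; rfl
  have main := AbelianSubgroup.L_zpow_mul_R_zpow hQ hX a
  simp only [hf.zpow_apply_zpow_add_zpow] at main
  refine ⟨hf, fun x y z => ?_, ?_, fun x y => ?_, fun i j x y => ?_, fun i j x y => ?_⟩
  · rw [hf.moufangMu_apply, hf.moufangMu_apply, hf.moufangMu_apply, hf.add_right,
      add_add_add_comm]
  · ext1 y
    rw [hf.moufangMu_apply, hf.beta_zero_left, add_zero, Equiv.Perm.one_apply]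
  · ext1 z
    rw [Equiv.Perm.mul_apply, hf.moufangMu_apply, hf.moufangMu_apply, hf.moufangMu_apply,
      hf.add_left, hf.add_right, hf.symmetric x (moufangBeta _ y z), hf.radical, add_zero,
      add_assoc, add_comm (moufangBeta _ x z)]
  · rw [hL, hR, hL, main]
  -- As a³ʲy = f³ʲ(y)a³ʲ, the first formula applies; β(x, f³ʲ(y)) = f⁻³ʲ(β(x, y)) shifts the
  -- interval by j.
  · have e : (AlgLoop.L a ^ (3 * j)) (y : Q) =
        (AlgLoop.R a ^ (3 * j)) (((X.conj hX a ^ (3 * j)) y : X) : Q) := by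
      rw [hQ.L_zpow_eq, AbelianSubgroup.coe_conj_zpow, Equiv.Perm.mul_apply]
    rw [hL, hL, hL, e, main, hf.beta_zpow_right, intInterval_comm (i + j),
      show intInterval (-j) (i + j) = intInterval (-2 * j + j) (i + j) by ring_nf,
      ← sum_intInterval_shift]
    simp only [← Equiv.Perm.mul_apply, ← zpow_add]
    congr! 5 with k
    all_goals ring_nf
    simp
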